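/- Let $\mathfrak g$ be a finite-dimensional complex simple Lie algebra, $\mathfrak h$ a Cartan subalgebra, and fix a base of simple roots; let $P_+\subset\mathfrak h^*$ be the set of dominant integral weights. For $\lambda,\nu\in P_+$ let $(\pi_\lambda,V_\lambda)$ and $(\pi_\nu,V_\nu)$ be finite-dimensional irreducible $\mathfrak g$-modules with highest weights $\lambda$ and $\nu$, and assume that $V_\lambda$ is multiplicity free, i.e. every nonzero weight space of $V_\lambda$ with respect to $\mathfrak h$ has dimension one. Let $x_1,\dots,x_m$ be any basis of $\mathfrak g$, let $x_1^*,\dots,x_m^*$ be its dual basis with respect to the Killing form, and put $$M_{\lambda,\nu}(C)=\sum_{i=1}^m \pi_\lambda(x_i)\otimes\pi_\nu(x_i^*)\in \operatorname{End}V_\lambda\otimes\operatorname{End}V_\nu ,\qquad R_{\lambda,\nu}(\mathfrak g)=(\operatorname{End}V_\lambda\otimes\operatorname{End}V_\nu)^{\mathfrak g}.$$ Then $V_\lambda\otimes V_\nu$ is a direct sum of irreducible $\mathfrak g$-submodules. Moreover, for every decomposition $V_\lambda\otimes V_\nu=N_1\oplus\dots\oplus N_s$ into irreducible $\mathfrak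 g$-submodules, $M_{\lambda,\nu}(C)$ acts on each $N_i$ by a scalar $c_i\in\mathbb C$, and $c_1,\dots,c_s$ are pairwise distinct if and only if $1,M_{\lambda,\nu}(C),\dots,M_{\lambda,\nu}(C)^{s-1}$ form a $\mathbb C$-basis of $R_{\lambda,\nu}(\mathfrak g)$. -/

import Mathlib

open scoped TensorProduct

noncomputable section

namespace SMF

open LieAlgebra LieModule Module

section Weights

variable {𝔤 : Type*} [LieRing 𝔤] [LieAlgebra ℂ 𝔤] [FiniteDimensional ℂ 𝔤] [IsSimple ℂ 𝔤]
  {H : LieSubalgebra ℂ 𝔤} [H.IsCartanSubalgebra]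

/-- `μ` belongs to `P₊`: a linear form on the Cartan subalgebra `H` is a dominant integral weight
if its value at every simple coroot is a nonnegative integer. -/
def IsDominantIntegral (Δ : (IsKilling.rootSystem H).Base) (μ : Dual ℂ H) : Prop :=
  ∀ i ∈ Δ.support, ∃ n : ℕ, μ ((IsKilling.rootSystem H).coroot i) = n

/-- `μ` is the highest weight of the irreducible `𝔤`-module `V`: some nonzero vector has weight `μ`
and is annihilated by every root space of a positive root. -/
def HasHighestWeight (Δ : (IsKilling.rootSystem H).Base) (μ : Dual ℂ H)
    (V : Type*) [AddCommGroup V] [Module ℂ V] [LieRingModule 𝔤 V] [LieModule ℂ 𝔤 V] : Prop :=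
  ∃ v : V, v ≠ 0 ∧ (∀ h : H, ⁅(h : 𝔤), v⁆ = μ h • v) ∧
    ∀ α : H.root, Δ.IsPos α → ∀ x ∈ rootSpace H (α : Weight ℂ H 𝔤), ⁅x, v⁆ = 0

/-- Every (nonzero) weight space of `V` with respect to the Cartan subalgebra `H` has dimension
one. -/
def IsMultiplicityFree (H : LieSubalgebra ℂ 𝔤) [H.IsCartanSubalgebra]
    (V : Type*) [AddCommGroup V] [Module ℂ V] [LieRingModule 𝔤 V] [LieModule ℂ 𝔤 V] : Prop :=
  ∀ μ : H → ℂ, weightSpace V μ ≠ ⊥ → finrank ℂ (weightSpace V μ) = 1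

end Weights

section Invariants

variable (𝔤 : Type*) [LieRing 𝔤] [LieAlgebra ℂ 𝔤]
  (V W : Type*) [AddCommGroup V] [Module ℂ V] [LieRingModule 𝔤 V] [LieModule ℂ 𝔤 V]
  [AddCommGroup W] [Module ℂ W] [LieRingModule 𝔤 W] [LieModule ℂ 𝔤 W]

/-- Elements of `𝔤` act on the algebra `End V ⊗ End W` by derivations. -/
theorem lie_mul_end (x : 𝔤) (a b : End ℂ V ⊗[ℂ] End ℂ W) :
    ⁅x, a * b⁆ = ⁅x, a⁆ * b + a * ⁅x, b⁆ := by
  have keyV : ∀ f g : End ℂ V, ⁅x, f * g⁆ = ⁅x, f⁆ * g + f * ⁅x, g⁆ := by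
    intro f g
    ext v
    simp
  have keyW : ∀ f g : End ℂ W, ⁅x, f * g⁆ = ⁅x, f⁆ * g + f * ⁅x, g⁆ := by
    intro f g
    ext w
    simp
  induction a with
  | zero => simp
  | add a₁ a₂ h₁ h₂ => simp only [add_mul, lie_add, h₁, h₂]; abel
  | tmul f g =>
    induction b with
    | zero => simp
    | add b₁ b₂ h₁ h₂ => simp only [mul_add, lie_add, h₁, h₂]; abel
    | tmul f' g' =>
      simp only [Algebra.TensorProduct.tmul_mul_tmul, TensorProduct.LieModule.lie_tmul_right,
        keyV, keyW, TensorProduct.add_tmul, TensorProduct.tmul_add, add_mul, mul_add]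
      abel

/-- The algebra `(End V ⊗ End W)^𝔤` of invariants of `𝔤` acting on `End V ⊗ End W` (where `x : 𝔤`
acts on `End V` by `f ↦ x ∘ f - f ∘ x`, and likewise on `End W`). -/
def invariantAlgebra : Subalgebra ℂ (End ℂ V ⊗[ℂ] End ℂ W) where
  carrier := {a | ∀ x : 𝔤, ⁅x, a⁆ = 0}
  mul_mem' {a b} ha hb x := by rw [lie_mul_end, ha x, hb x, zero_mul, mul_zero, add_zero]
  add_mem' {a b} ha hb x := by rw [lie_add, ha x, hb x, add_zero]
  algebraMap_mem' r x := by
    have hV : ⁅x, algebraMap ℂ (End ℂ V) r⁆ = 0 := by ext; simp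
    have hW : ⁅x, (1 : End ℂ W)⁆ = 0 := by ext; simp
    rw [Algebra.TensorProduct.algebraMap_apply, TensorProduct.LieModule.lie_tmul_right,
      hV, hW, TensorProduct.zero_tmul, TensorProduct.tmul_zero, add_zero]

end Invariants

section Casimir

variable {𝔤 : Type*} [LieRing 𝔤] [LieAlgebra ℂ 𝔤] [FiniteDimensional ℂ 𝔤] [IsSimple ℂ 𝔤]
  {ι : Type*} [Fintype ι] [DecidableEq ι] (x : Basis ι ℂ 𝔤)

/-- The basis of `𝔤` dual to the basis `x` with respect to the Killing form. -/
def killingDualBasis : Basis ι ℂ 𝔤 :=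
  LinearMap.BilinForm.dualBasis (killingForm ℂ 𝔤) (IsKilling.killingForm_nondegenerate ℂ 𝔤) x

variable (V W : Type*) [AddCommGroup V] [Module ℂ V] [LieRingModule 𝔤 V] [LieModule ℂ 𝔤 V]
  [AddCommGroup W] [Module ℂ W] [LieRingModule 𝔤 W] [LieModule ℂ 𝔤 W]

/-- `M(C) = ∑ i, π_V (x i) ⊗ π_W (x i)*` in `End V ⊗ End W`. -/
def casimirM : End ℂ V ⊗[ℂ] End ℂ W :=
  ∑ i, toEnd ℂ 𝔤 V (x i) ⊗ₜ[ℂ] toEnd ℂ 𝔤 W (killingDualBasis x i)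

/-- The operator by which an element of `End V ⊗ End W` acts on `V ⊗ W`. -/
def tensorOp {V W : Type*} [AddCommGroup V] [Module ℂ V] [AddCommGroup W] [Module ℂ W] :
    End ℂ V ⊗[ℂ] End ℂ W →ₐ[ℂ] End ℂ (V ⊗[ℂ] W) :=
  Module.endTensorEndAlgHom

end Casimir

/-- `U` is the internal direct sum of the irreducible `𝔤`-submodules `N 0, …, N (s - 1)`. -/
structure IsIrreducibleDecomposition {𝔤 : Type*} [LieRing 𝔤] [LieAlgebra ℂ 𝔤]
    {U : Type*} [AddCommGroup U] [Module ℂ U] [LieRingModule 𝔤 U] [LieModule ℂ 𝔤 U]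
    {s : ℕ} (N : Fin s → LieSubmodule ℂ 𝔤 U) : Prop where
  irreducible : ∀ i, LieModule.IsIrreducible ℂ 𝔤 (N i)
  isInternal : DirectSum.IsInternal fun i => (N i).toSubmodule

end SMF

end

open scoped TensorProduct

noncomputable section

namespace SMF

open LieAlgebra LieModule Module

/-! ### Dual bases, invariant tensors and Casimir operators -/

section DualBasis

variable {K L M ι : Type*} [Field K] [LieRing L] [LieAlgebra K L] [AddCommGroup M] [Module K M]
  [Fintype ι] [DecidableEq ι]
  {Φ : LinearMap.BilinForm K L} (hΦ : Φ.Nondegenerate) (b : Basis ι K L)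

/-! On `V ⊗ W` the Casimir operator of the Killing form equals a scalar plus `2 M(C)`: expanding the
coproduct gives the Casimirs of `V` and `W`, scalar by Schur, and two equal cross terms
(`exists_casimirEnd_eq`). So `M(C)` preserves every submodule and is a scalar `c i` on each
irreducible `N i`. Existence of a decomposition is Weyl's theorem, obtained from Whitehead's first
lemma.

Invariants are exactly the `𝔤`-endomorphisms of `V ⊗ W`, and these commute with the Casimir, hence
with `M(C)`. If the `c i` are distinct, the `N i` are the eigenspaces of `M(C)`, so each invariant
preserves them and is a scalar on each by Schur; Lagrange interpolation makes it a unique polynomial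
of degree `< s` in `M(C)`. Conversely, if two of the `c i` agree, a monic polynomial of degree `s -
1` annihilates `M(C)`, and the powers are dependent. -/

theorem sum_apply_dualBasis_smul (z : L) : ∑ j, Φ z (b j) • Φ.dualBasis hΦ b j = z := by
  conv_rhs => rw [← (Φ.dualBasis hΦ b).sum_repr z]
  simp only [LinearMap.BilinForm.dualBasis_repr_apply]

theorem sum_apply_dualBasis_smul' (hs : Φ.IsSymm) (z : L) :
    ∑ j, Φ z (Φ.dualBasis hΦ b j) • b j = z := by
  have h := sum_apply_dualBasis_smul hΦ (Φ.dualBasis hΦ b) z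
  rwa [LinearMap.BilinForm.dualBasis_dualBasis hΦ hs] at h

/-- The canonical tensor `∑ i, b i ⊗ (b i)*` of an invariant form is killed by `L`. -/
theorem sum_lie_dualBasis_add (hs : Φ.IsSymm) (hi : Φ.lieInvariant L) (f : L →ₗ[K] L →ₗ[K] M)
    (x : L) :
    ∑ i, (f ⁅x, b i⁆ (Φ.dualBasis hΦ b i) + f (b i) ⁅x, Φ.dualBasis hΦ b i⁆) = 0 := by
  set d := Φ.dualBasis hΦ b with hd
  have h1 : ∀ i, f ⁅x, b i⁆ (d i) = ∑ j, Φ ⁅x, b i⁆ (d j) • f (b j) (d i) := fun i => by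
    conv_lhs => rw [← sum_apply_dualBasis_smul' hΦ b hs ⁅x, b i⁆]
    simp [hd]
  have h2 : ∀ i, f (b i) ⁅x, d i⁆ = ∑ j, Φ ⁅x, d i⁆ (b j) • f (b i) (d j) := fun i => by
    conv_lhs => rw [← sum_apply_dualBasis_smul hΦ b ⁅x, d i⁆]
    simp [hd]
  rw [Finset.sum_add_distrib, Finset.sum_congr rfl fun i _ => h1 i,
    Finset.sum_congr rfl fun i _ => h2 i, Finset.sum_comm, ← Finset.sum_add_distrib]
  refine Finset.sum_eq_zero fun i _ => ?_
  rw [← Finset.sum_add_distrib]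
  refine Finset.sum_eq_zero fun j _ => ?_
  rw [hi x (b j) (d i), hs.eq ⁅x, d i⁆ (b j), neg_smul, neg_add_cancel]

/-- The canonical tensor `∑ i, b i ⊗ (b i)*` of a symmetric form is symmetric. -/
theorem sum_dualBasis_comm (hs : Φ.IsSymm) (f : L →ₗ[K] L →ₗ[K] M) :
    ∑ i, f (Φ.dualBasis hΦ b i) (b i) = ∑ i, f (b i) (Φ.dualBasis hΦ b i) := by
  set d := Φ.dualBasis hΦ b with hd
  have h1 : ∀ i, f (d i) (b i) = ∑ j, Φ (b i) (b j) • f (d i) (d j) := fun i => by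
    conv_lhs => rw [← sum_apply_dualBasis_smul hΦ b (b i)]
    simp [hd]
  have h2 : ∀ i, f (b i) (d i) = ∑ j, Φ (b i) (b j) • f (d j) (d i) := fun i => by
    conv_lhs => rw [← sum_apply_dualBasis_smul hΦ b (b i)]
    simp [hd]
  rw [Finset.sum_congr rfl fun i _ => h1 i, Finset.sum_congr rfl fun i _ => h2 i,
    Finset.sum_comm]
  refine Finset.sum_congr rfl fun i _ => Finset.sum_congr rfl fun j _ => ?_
  rw [hs.eq]

variable [LieRingModule L M] [LieModule K L M]

variable (M) in
/-- The Casimir operator on `M` of a nondegenerate bilinear form on `L`. -/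
def casimirEnd : End K M := ∑ i, toEnd K L M (b i) * toEnd K L M (Φ.dualBasis hΦ b i)

theorem casimirEnd_apply (m : M) :
    casimirEnd M hΦ b m = ∑ i, ⁅b i, ⁅Φ.dualBasis hΦ b i, m⁆⁆ := by
  simp [casimirEnd]

/-- Contract the invariant tensor with `(y, z) ↦ ⁅y, f z⁆`; the cocycle identity accounts exactly
for the difference of the two sides. -/
theorem lie_sum_lie_cocycle (hs : Φ.IsSymm) (hi : Φ.lieInvariant L) (f : L →ₗ[K] M)
    (hf : ∀ x y, f ⁅x, y⁆ = ⁅x, f y⁆ - ⁅y, f x⁆) (x : L) :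
    ⁅x, ∑ i, ⁅b i, f (Φ.dualBasis hΦ b i)⁆⁆ = casimirEnd M hΦ b (f x) := by
  have h := sum_lie_dualBasis_add hΦ b hs hi
    ((LinearMap.lcomp K M f).comp (toEnd K L M : L →ₗ[K] End K M)) x
  rw [casimirEnd_apply, lie_sum, ← sub_eq_zero, ← Finset.sum_sub_distrib, ← h]
  refine Finset.sum_congr rfl fun i _ => ?_
  simp only [LinearMap.comp_apply, LinearMap.lcomp_apply, LieHom.coe_toLinearMap,
    toEnd_apply_apply, hf, lie_sub, leibniz_lie x]
  abel

/-- This is the preceding identity for the coboundary `y ↦ ⁅y, m⁆`. -/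
theorem casimirEnd_lie (hs : Φ.IsSymm) (hi : Φ.lieInvariant L) (x : L) (m : M) :
    casimirEnd M hΦ b ⁅x, m⁆ = ⁅x, casimirEnd M hΦ b m⁆ := by
  have h := lie_sum_lie_cocycle hΦ b hs hi ((toEnd K L M : L →ₗ[K] End K M).flip m)
    (fun x y => by simp) x
  simpa [casimirEnd_apply] using h.symm

end DualBasis

/-! ### Whitehead's first lemma and complete reducibility -/

section Whitehead

variable {K L : Type*} [Field K] [LieRing L] [LieAlgebra K L]

theorem lie_top_top_of_isSimple [IsSimple K L] : derivedSeries K L 1 = ⊤ := by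
  refine (IsSimple.eq_bot_or_eq_top (R := K) (derivedSeries K L 1)).resolve_left fun h => ?_
  apply IsSimple.non_abelian (R := K) (L := L)
  refine ⟨fun x y => ?_⟩
  have hxy : ⁅x, y⁆ ∈ derivedSeries K L 1 :=
    LieSubmodule.lie_mem_lie (LieSubmodule.mem_top x) (LieSubmodule.mem_top y)
  rwa [h] at hxy

variable (K L) (M : Type*) [AddCommGroup M] [Module K M] [LieRingModule L M] [LieModule K L M]

/-- A vanishing trace form makes `[L, L] = L` act nilpotently, so there is a nonzero invariant
vector; by irreducibility the invariants are everything. -/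
theorem isTrivial_of_traceForm_eq_zero [CharZero K] [FiniteDimensional K L] [IsSimple K L]
    [FiniteDimensional K M] [IsIrreducible K L M] (h : traceForm K L M = 0) :
    LieModule.IsTrivial L M := by
  have hn := isNilpotent_derivedSeries_of_traceForm_eq_zero (R := K) (L := L) (M := M) h
  have : Nontrivial M := nontrivial_of_isIrreducible K L M
  have h1 := nontrivial_max_triv_of_isNilpotent K (derivedSeries K L 1) M
  obtain ⟨⟨v, hv⟩, hv0⟩ := exists_ne (0 : maxTrivSubmodule K (derivedSeries K L 1) M)
  have hv' : v ∈ maxTrivSubmodule K L M := by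
    intro x
    exact hv ⟨x, by rw [lie_top_top_of_isSimple]; trivial⟩
  rw [LieModule.isTrivial_iff_max_triv_eq_top (R := K)]
  refine (IsSimpleOrder.eq_bot_or_eq_top (maxTrivSubmodule K L M)).resolve_left fun h0 => hv0 ?_
  rw [h0] at hv'
  exact Subtype.ext hv'

end Whitehead

theorem isIrreducible_of_isAtom {K L M : Type*} [CommRing K] [LieRing L] [AddCommGroup M]
    [Module K M] [LieRingModule L M] {N : LieSubmodule K L M} (hN : IsAtom N) :
    IsIrreducible K L N := by
  have : Nontrivial N := (LieSubmodule.nontrivial_iff_ne_bot K L M).2 hN.1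
  refine IsIrreducible.mk fun N' hN' => ?_
  have hle : N'.map N.incl ≤ N := LieSubmodule.map_incl_le
  rcases hN.le_iff.1 hle with h | h
  · refine absurd ((LieSubmodule.eq_bot_iff N').2 fun n hn => ?_) hN'
    have : (n : M) ∈ N'.map N.incl := LieSubmodule.mem_map_of_mem hn
    rw [h] at this
    exact Subtype.ext this
  · refine eq_top_iff.2 fun n _ => ?_
    have hn : (n : M) ∈ N'.map N.incl := by rw [h]; exact n.2
    obtain ⟨n', hn', heq⟩ := (LieSubmodule.mem_map _).1 hn
    rwa [← Subtype.ext (a1 := n') (a2 := n) heq]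

section Whitehead

variable (K L : Type*) [Field K] [CharZero K] [LieRing L] [LieAlgebra K L]
  [FiniteDimensional K L] [IsSimple K L]

/-- The radical is an ideal, and it is not all of `L` because the trace form is nonzero. -/
theorem nondegenerate_traceForm (M : Type*) [AddCommGroup M] [Module K M] [LieRingModule L M]
    [LieModule K L M] [FiniteDimensional K M] [IsIrreducible K L M]
    (h : ¬ LieModule.IsTrivial L M) : (traceForm K L M).Nondegenerate := by
  have key : ∀ y, (∀ x, traceForm K L M x y = 0) → y = 0 := by
    intro y hy
    have hmem : y ∈ InvariantForm.orthogonal (traceForm K L M) (traceForm_lieInvariant K L M) ⊤ :=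
      (InvariantForm.mem_orthogonal _ _ _ _).2 fun x _ => hy x
    rcases IsSimple.eq_bot_or_eq_top (R := K)
      (InvariantForm.orthogonal (traceForm K L M) (traceForm_lieInvariant K L M) ⊤) with h0 | h0
    · rwa [h0] at hmem
    · refine absurd (isTrivial_of_traceForm_eq_zero K L M ?_) h
      ext x z
      have hz : z ∈ (⊤ : LieSubmodule K L L) := LieSubmodule.mem_top z
      rw [← h0, InvariantForm.mem_orthogonal] at hz
      exact hz x (LieSubmodule.mem_top x)
  exact ⟨fun x hx => key x fun y => by rw [traceForm_comm]; exact hx y, key⟩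

/-- The trace of this Casimir is `dim L`, nonzero in characteristic zero, so its kernel is a proper
submodule, hence zero. -/
theorem casimirEnd_traceForm_bijective (M : Type*) [AddCommGroup M] [Module K M]
    [LieRingModule L M] [LieModule K L M] [FiniteDimensional K M] [IsIrreducible K L M]
    {ι : Type*} [Fintype ι] [DecidableEq ι] (b : Basis ι K L)
    (h : (traceForm K L M).Nondegenerate) : Function.Bijective (casimirEnd M h b) := by
  have hs : (traceForm K L M).IsSymm := ⟨fun x y => traceForm_comm K L M x y⟩
  have htr : LinearMap.trace K M (casimirEnd M h b) = Fintype.card ι := by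
    rw [casimirEnd, map_sum]
    have : ∀ i, LinearMap.trace K M
        (toEnd K L M (b i) * toEnd K L M ((traceForm K L M).dualBasis h b i)) = 1 := fun i => by
      have := LinearMap.BilinForm.apply_dualBasis_right h hs b i i
      rwa [if_pos rfl] at this
    simp [this]
  have hcard : (Fintype.card ι : K) ≠ 0 := by
    have : Nontrivial L := by
      by_contra hL
      rw [not_nontrivial_iff_subsingleton] at hL
      exact IsSimple.non_abelian (R := K) (L := L) ⟨fun x y => Subsingleton.elim _ _⟩
    have := b.index_nonempty
    exact_mod_cast Fintype.card_ne_zero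
  let C : M →ₗ⁅K,L⁆ M :=
    { casimirEnd M h b with
      map_lie' := fun {x m} => casimirEnd_lie h b hs (traceForm_lieInvariant K L M) x m }
  have hker : LinearMap.ker (casimirEnd M h b) = ⊥ := by
    rcases IsSimpleOrder.eq_bot_or_eq_top C.ker with h0 | h0
    · rw [← LieSubmodule.toSubmodule_eq_bot] at h0
      exact h0
    · refine absurd htr ?_
      have : casimirEnd M h b = 0 := by
        ext m
        have hm : m ∈ C.ker := h0 ▸ LieSubmodule.mem_top m
        exact hm
      rw [this, map_zero]
      exact hcard.symm
  have hinj := LinearMap.ker_eq_bot.1 hker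
  exact ⟨hinj, LinearMap.injective_iff_surjective.1 hinj⟩

theorem exists_lie_eq_of_cocycle_of_isIrreducible (M : Type*) [AddCommGroup M] [Module K M]
    [LieRingModule L M] [LieModule K L M] [FiniteDimensional K M] [IsIrreducible K L M]
    (f : L →ₗ[K] M) (hf : ∀ x y, f ⁅x, y⁆ = ⁅x, f y⁆ - ⁅y, f x⁆) :
    ∃ m : M, ∀ x, f x = ⁅x, m⁆ := by
  by_cases ht : LieModule.IsTrivial L M
  -- On a trivial module a cocycle vanishes on brackets, and these span `L`.
  · refine ⟨0, fun x => ?_⟩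
    have hx : x ∈ derivedSeries K L 1 := by rw [lie_top_top_of_isSimple]; trivial
    rw [lie_zero]
    change x ∈ ⁅(⊤ : LieIdeal K L), (⊤ : LieIdeal K L)⁆ at hx
    rw [← LieSubmodule.mem_toSubmodule, LieSubmodule.lieIdeal_oper_eq_linear_span'] at hx
    induction hx using Submodule.span_induction with
    | mem z hz =>
      obtain ⟨x, -, y, -, rfl⟩ := hz
      rw [hf, ht.trivial, ht.trivial, sub_zero]
    | zero => simp
    | add x y _ _ hx hy => simp [hx, hy]
    | smul a x _ hx => simp [hx]
  · have h := nondegenerate_traceForm K L M ht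
    have hs : (traceForm K L M).IsSymm := ⟨fun x y => traceForm_comm K L M x y⟩
    have hi := traceForm_lieInvariant K L M
    let b := finBasis K L
    have hC := casimirEnd_traceForm_bijective K L M b h
    -- With this `m`, the Casimir sends both `f x` and `⁅x, m⁆` to the same vector; injectivity
    -- concludes.
    obtain ⟨m, hm⟩ := hC.2 (∑ i, ⁅b i, f ((traceForm K L M).dualBasis h b i)⁆)
    refine ⟨m, fun x => hC.1 ?_⟩
    rw [casimirEnd_lie h b hs hi, hm, lie_sum_lie_cocycle h b hs hi f hf]

/-- Whitehead's first lemma: `H¹(L, M) = 0`. -/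
theorem exists_lie_eq_of_cocycle (M : Type*) [AddCommGroup M] [Module K M]
    [LieRingModule L M] [LieModule K L M] [FiniteDimensional K M]
    (f : L →ₗ[K] M) (hf : ∀ x y, f ⁅x, y⁆ = ⁅x, f y⁆ - ⁅y, f x⁆) :
    ∃ m : M, ∀ x, f x = ⁅x, m⁆ := by
  induction hn : finrank K M using Nat.strong_induction_on generalizing M with
  | _ n ih =>
  subst hn
  rcases subsingleton_or_nontrivial M with hM | hM
  · exact ⟨0, fun x => Subsingleton.elim _ _⟩
  by_cases hirr : IsIrreducible K L M
  · exact exists_lie_eq_of_cocycle_of_isIrreducible K L M f hf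
  obtain ⟨N, hN0, hN1⟩ : ∃ N : LieSubmodule K L M, N ≠ ⊥ ∧ N ≠ ⊤ := by
    by_contra! hcon
    exact hirr (IsIrreducible.mk hcon)
  have hlt1 : finrank K (M ⧸ N) < finrank K M := by
    have h1 := Submodule.finrank_quotient_add_finrank N.toSubmodule
    have h2 : 0 < finrank K N.toSubmodule := by
      rw [Module.finrank_pos_iff, Submodule.nontrivial_iff_ne_bot]
      exact fun h0 => hN0 ((LieSubmodule.toSubmodule_eq_bot N).1 h0)
    change finrank K (M ⧸ N.toSubmodule) < _
    omega
  have hlt2 : finrank K N < finrank K M := by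
    refine Submodule.finrank_lt (s := N.toSubmodule) ?_
    rw [Ne, LieSubmodule.toSubmodule_eq_top]
    exact hN1
  obtain ⟨q, hq⟩ := ih _ hlt1 (M ⧸ N)
    ((LieSubmodule.Quotient.mk' N : M →ₗ[K] M ⧸ N).comp f) (fun x y => by
      simp only [LinearMap.comp_apply, hf, map_sub]
      rfl) rfl
  obtain ⟨m, rfl⟩ := LieSubmodule.Quotient.surjective_mk' N q
  have hmem : ∀ x, f x - ⁅x, m⁆ ∈ N := fun x => by
    rw [← LieSubmodule.Quotient.mk_eq_zero, map_sub, LieModuleHom.map_lie, ← hq, sub_eq_zero]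
    rfl
  -- Subtracting the coboundary of a lift of `q` leaves a cocycle with values in `N`, to which
  -- induction applies again.
  let g : L →ₗ[K] N := (f - (toEnd K L M : L →ₗ[K] End K M).flip m).codRestrict N.toSubmodule hmem
  have hg : ∀ x, ((g x : N) : M) = f x - ⁅x, m⁆ := fun x => rfl
  obtain ⟨n, hn⟩ := ih _ hlt2 N g (fun x y => by
    apply Subtype.ext
    rw [LieSubmodule.coe_sub, LieSubmodule.coe_bracket, LieSubmodule.coe_bracket, hg, hg, hg, hf,
      lie_sub, lie_sub, lie_lie]
    abel) rfl
  refine ⟨m + n, fun x => ?_⟩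
  have := congrArg (Subtype.val) (hn x)
  rw [hg, LieSubmodule.coe_bracket] at this
  rw [lie_add, ← this]
  abel

/-- Weyl's theorem on complete reducibility. -/
theorem exists_isCompl_lieSubmodule (M : Type*) [AddCommGroup M] [Module K M]
    [LieRingModule L M] [LieModule K L M] [FiniteDimensional K M] (N : LieSubmodule K L M) :
    ∃ N' : LieSubmodule K L M, IsCompl N N' := by
  obtain ⟨p, hp⟩ := LinearMap.exists_leftInverse_of_injective N.toSubmodule.subtype
    N.toSubmodule.ker_subtype
  replace hp : ∀ n : N, p n = n := fun n => LinearMap.congr_fun hp n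
  let p' : M →ₗ[K] N := p
  -- For a linear projection `p'` onto `N`, the failure of equivariance `x ↦ ⁅x, p'⁆` takes values
  -- in maps killing `N`. Whitehead writes it as `⁅x, φ⁆` with `φ` in `S`, so `p' - φ` is an
  -- equivariant projection.
  let S : LieSubmodule K L (M →ₗ[K] N) :=
    { carrier := {φ | ∀ n ∈ N, φ n = 0}
      add_mem' := fun {φ ψ} hφ hψ n hn => by rw [LinearMap.add_apply, hφ n hn, hψ n hn, add_zero]
      zero_mem' := fun n _ => rfl
      smul_mem' := fun a φ hφ n hn => by rw [LinearMap.smul_apply, hφ n hn, smul_zero]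
      lie_mem := fun {x φ} hφ n hn => by
        rw [LieHom.lie_apply, hφ n hn, hφ _ (N.lie_mem hn), lie_zero, sub_zero] }
  have hS : ∀ x : L, ⁅x, p'⁆ ∈ S := fun x n hn => by
    have h1 : p' n = ⟨n, hn⟩ := hp ⟨n, hn⟩
    have h2 : p' ⁅x, n⁆ = ⟨⁅x, n⁆, N.lie_mem hn⟩ := hp ⟨_, N.lie_mem hn⟩
    rw [LieHom.lie_apply, h1, h2]
    exact sub_self _
  let f : L →ₗ[K] S := ((toEnd K L (M →ₗ[K] N) : L →ₗ[K] End K (M →ₗ[K] N)).flip p').codRestrict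
    S.toSubmodule hS
  have hf : ∀ x, ((f x : S) : M →ₗ[K] N) = ⁅x, p'⁆ := fun x => rfl
  obtain ⟨⟨φ, hφ⟩, hφ'⟩ := exists_lie_eq_of_cocycle K L S f (fun x y => by
    apply Subtype.ext
    rw [LieSubmodule.coe_sub, LieSubmodule.coe_bracket, LieSubmodule.coe_bracket, hf, hf, hf,
      lie_lie])
  have hq0 : ∀ x : L, ⁅x, p' - φ⁆ = 0 := fun x => by
    rw [lie_sub, sub_eq_zero, ← hf, hφ']
    rfl
  have hq : ∀ (x : L) (m : M), (p' - φ) ⁅x, m⁆ = ⁅x, (p' - φ) m⁆ := fun x m => by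
    have := LinearMap.congr_fun (hq0 x) m
    rw [LieHom.lie_apply, LinearMap.zero_apply, sub_eq_zero] at this
    exact this.symm
  let q : M →ₗ⁅K,L⁆ N := { p' - φ with map_lie' := fun {x m} => hq x m }
  refine ⟨q.ker, ?_⟩
  rw [← LieSubmodule.isCompl_toSubmodule]
  refine LinearMap.isCompl_of_proj (p := N.toSubmodule) (f := p' - φ) fun n => ?_
  rw [LinearMap.sub_apply, hφ n n.2, sub_zero]
  exact hp n

/-- Every finite-dimensional module over a simple Lie algebra is a direct sum of finitely many
irreducible submodules. -/
theorem exists_isInternal_isIrreducible (M : Type*) [AddCommGroup M] [Module K M]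
    [LieRingModule L M] [LieModule K L M] [FiniteDimensional K M] :
    ∃ (s : ℕ) (N : Fin s → LieSubmodule K L M), (∀ i, IsIrreducible K L (N i)) ∧
      DirectSum.IsInternal fun i => (N i).toSubmodule := by
  have : ComplementedLattice (LieSubmodule K L M) := ⟨exists_isCompl_lieSubmodule K L M⟩
  obtain ⟨S, hS, htop, hatom⟩ := exists_sSupIndep_of_sSup_atoms_eq_top
    (sSup_atoms_eq_top (α := LieSubmodule K L M))
  have hfin : S.Finite := WellFoundedGT.finite_of_sSupIndep hS
  have := hfin.to_subtype
  let e := (Finite.equivFin S).symm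
  refine ⟨Nat.card S, fun i => (e i : LieSubmodule K L M), fun i => ?_, ?_⟩
  · exact isIrreducible_of_isAtom (hatom (e i).2)
  · rw [DirectSum.isInternal_submodule_iff_iSupIndep_and_iSup_eq_top]
    constructor
    · rw [LieSubmodule.iSupIndep_toSubmodule]
      exact ((sSupIndep_iff S).1 hS).comp e.injective
    · rw [← LieSubmodule.iSup_toSubmodule, LieSubmodule.toSubmodule_eq_top, ← htop, sSup_eq_iSup']
      exact e.surjective.iSup_comp _

end Whitehead

/-- Schur's lemma. -/
theorem exists_eq_smul_of_commute {K L M : Type*} [Field K] [IsAlgClosed K] [LieRing L]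
    [LieAlgebra K L] [AddCommGroup M] [Module K M] [LieRingModule L M] [LieModule K L M]
    [FiniteDimensional K M] [IsIrreducible K L M] (T : End K M)
    (hT : ∀ (x : L) (m : M), T ⁅x, m⁆ = ⁅x, T m⁆) : ∃ c : K, ∀ m, T m = c • m := by
  have : Nontrivial M := nontrivial_of_isIrreducible K L M
  obtain ⟨c, hc⟩ := End.exists_eigenvalue T
  let E : LieSubmodule K L M :=
    { T.eigenspace c with
      lie_mem := fun {x m} hm => by
        change m ∈ T.eigenspace c at hm
        change ⁅x, m⁆ ∈ T.eigenspace c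
        rw [End.mem_eigenspace_iff] at hm ⊢
        rw [hT, hm, lie_smul] }
  refine ⟨c, fun m => ?_⟩
  have hE : E = ⊤ := (IsSimpleOrder.eq_bot_or_eq_top E).resolve_left fun h =>
    hc ((LieSubmodule.toSubmodule_eq_bot E).2 h)
  exact End.mem_eigenspace_iff.1 (show m ∈ E from hE ▸ LieSubmodule.mem_top m)

/-! ### Linear algebra of an operator that is scalar on each summand -/

section Spectral

variable {K A U : Type*} [Field K] [Semiring A] [Algebra K A] [AddCommGroup U] [Module K U]
  {s : ℕ} {N : Fin s → Submodule K U} {c : Fin s → K}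

theorem aeval_apply_of_apply_eq_smul {f : End K U} {a : K} {u : U} (h : f u = a • u)
    (p : Polynomial K) : Polynomial.aeval f p u = p.eval a • u := by
  by_cases hu : u = 0
  · simp [hu]
  · exact End.aeval_apply_of_hasEigenvector ⟨End.mem_eigenspace_iff.2 h, hu⟩

theorem eq_of_forall_apply_eq (hN : DirectSum.IsInternal N) {f g : End K U}
    (h : ∀ i, ∀ u ∈ N i, f u = g u) : f = g := by
  ext u
  have hu : u ∈ ⨆ i, N i := hN.submodule_iSup_eq_top ▸ Submodule.mem_top
  induction hu using Submodule.iSup_induction' with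
  | mem i u hu => exact h i u hu
  | zero => simp
  | add u v _ _ hu hv => simp [hu, hv]

/-- An operator commuting with a diagonalizable one preserves its eigenspaces. -/
theorem apply_mem_of_commute (hN : DirectSum.IsInternal N) (hc : Function.Injective c)
    {f T : End K U} (hf : ∀ i, ∀ u ∈ N i, f u = c i • u) (hT : Commute T f) {i : Fin s} {u : U}
    (hu : u ∈ N i) : T u ∈ N i := by
  -- The Lagrange polynomial of the node `c i` turns `f` into the projection onto `N i` along the
  -- other summands; anything commuting with `f` commutes with it.
  set P := Polynomial.aeval f (Lagrange.basis Finset.univ c i) with hP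
  have hP1 : ∀ j, ∀ w ∈ N j, P w = (if j = i then (1 : K) else 0) • w := fun j w hw => by
    rw [hP, aeval_apply_of_apply_eq_smul (hf j w hw)]
    split_ifs with h
    · rw [h, Lagrange.eval_basis_self hc.injOn (Finset.mem_univ i)]
    · rw [Lagrange.eval_basis_of_ne (Ne.symm h) (Finset.mem_univ j)]
  have hPN : ∀ w, P w ∈ N i := fun w => by
    have hw : w ∈ ⨆ i, N i := hN.submodule_iSup_eq_top ▸ Submodule.mem_top
    induction hw using Submodule.iSup_induction' with
    | mem j w hw =>
      rw [hP1 j w hw]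
      split_ifs with h
      · exact (N i).smul_mem _ (h ▸ hw)
      · simp
    | zero => simp
    | add u v _ _ hu hv => rw [map_add]; exact (N i).add_mem hu hv
  have hcomm : Commute T P := by
    rw [hP]
    induction Lagrange.basis Finset.univ c i using Polynomial.induction_on' with
    | add p q hp hq => rw [map_add]; exact hp.add_right hq
    | monomial n a =>
      rw [Polynomial.aeval_monomial]
      exact (Algebra.commute_algebraMap_right a T).mul_right (hT.pow_right n)
  have h1 : P u = u := by rw [hP1 i u hu, if_pos rfl, one_smul]
  rw [← h1, ← Module.End.mul_apply, hcomm.eq]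
  exact hPN _

variable {ρ : A →ₐ[K] End K U} {m : A}

theorem eq_aeval_of_forall_apply_eq (hρ : Function.Injective ρ) (hN : DirectSum.IsInternal N)
    (hm : ∀ i, ∀ u ∈ N i, ρ m u = c i • u) {a : A} {p : Polynomial K}
    (h : ∀ i, ∀ u ∈ N i, ρ a u = p.eval (c i) • u) : a = Polynomial.aeval m p := by
  refine hρ (eq_of_forall_apply_eq hN fun i u hu => ?_)
  rw [h i u hu, ← Polynomial.aeval_algHom_apply, aeval_apply_of_apply_eq_smul (hm i u hu)]

theorem eval_eq_of_aeval_eq (hN0 : ∀ i, N i ≠ ⊥) (hm : ∀ i, ∀ u ∈ N i, ρ m u = c i • u)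
    {p q : Polynomial K} (h : Polynomial.aeval m p = Polynomial.aeval m q) (i : Fin s) :
    p.eval (c i) = q.eval (c i) := by
  obtain ⟨u, hu, hu0⟩ := (N i).exists_mem_ne_zero_of_ne_bot (hN0 i)
  have h1 := aeval_apply_of_apply_eq_smul (hm i u hu) p
  rw [Polynomial.aeval_algHom_apply, h, ← Polynomial.aeval_algHom_apply,
    aeval_apply_of_apply_eq_smul (hm i u hu)] at h1
  exact (smul_left_injective K hu0 h1).symm

/-- If the eigenvalues `c i` of `m` are distinct and every element of the subalgebra `R` acts by
scalars on the eigenspaces of `m`, then the powers `1, m, …, m ^ (s - 1)` form a basis of `R`. -/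
theorem exists_basis_pow (hρ : Function.Injective ρ) (hN : DirectSum.IsInternal N)
    (hN0 : ∀ i, N i ≠ ⊥) (hm : ∀ i, ∀ u ∈ N i, ρ m u = c i • u) (hc : Function.Injective c)
    (R : Subalgebra K A) (hmR : m ∈ R)
    (hR : ∀ a ∈ R, ∃ t : Fin s → K, ∀ i, ∀ u ∈ N i, ρ a u = t i • u) :
    ∃ B : Basis (Fin s) K R, ∀ k : Fin s, (B k : A) = m ^ (k : ℕ) := by
  let v : Fin s → R := fun k => ⟨m, hmR⟩ ^ (k : ℕ)
  have hv : ∀ k, (v k : A) = m ^ (k : ℕ) := fun k => rfl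
  have hli : LinearIndependent K v := by
    rw [Fintype.linearIndependent_iffₛ]
    intro f g hfg
    let p : (Fin s → K) → Polynomial K := fun f => ∑ k : Fin s, Polynomial.monomial (k : ℕ) (f k)
    have hpm : ∀ f, Polynomial.aeval m (p f) = ((∑ k, f k • v k : R) : A) := fun f => by
      simp [p, hv, Polynomial.aeval_monomial, Algebra.smul_def]
    have hdeg : ∀ f, (p f).degree < (Finset.univ : Finset (Fin s)).card := fun f => by
      rw [Finset.card_univ, Fintype.card_fin, ← Polynomial.mem_degreeLT]
      refine Submodule.sum_mem _ fun k _ => ?_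
      rw [Polynomial.mem_degreeLT]
      exact (Polynomial.degree_monomial_le _ _).trans_lt (by exact_mod_cast k.2)
    -- Two polynomials of degree `< s` agreeing at the `s` distinct nodes `c i` coincide.
    have heq : p f = p g := Polynomial.eq_of_degrees_lt_of_eval_index_eq _ hc.injOn (hdeg f)
      (hdeg g) fun i _ => eval_eq_of_aeval_eq hN0 hm (by rw [hpm, hpm, hfg]) i
    intro k
    have := congrArg (fun q => Polynomial.coeff q (k : ℕ)) heq
    simpa [p, Polynomial.finsetSum_coeff, Polynomial.coeff_monomial, Fin.val_inj] using this
  have hsp : ⊤ ≤ Submodule.span K (Set.range v) := by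
    rintro ⟨a, ha⟩ -
    obtain ⟨t, ht⟩ := hR a ha
    set p := Lagrange.interpolate Finset.univ c t with hp
    have hdeg : p.degree < s := by
      have := Lagrange.degree_interpolate_lt t (hc.injOn (s := (Finset.univ : Finset (Fin s))))
      rwa [Finset.card_univ, Fintype.card_fin] at this
    have hap : a = Polynomial.aeval m p := eq_aeval_of_forall_apply_eq hρ hN hm fun i u hu => by
      rw [ht i u hu, hp, Lagrange.eval_interpolate_at_node t hc.injOn (Finset.mem_univ i)]
    have hsum : (⟨a, ha⟩ : R) = ∑ k : Fin s, p.coeff k • v k := by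
      apply Subtype.ext
      change a = _
      -- When `s = 0` the zero polynomial has `natDegree` equal to `s`, so the bound needs `p ≠ 0`.
      by_cases hp0 : p = 0
      · simp [hap, hp0]
      · rw [hap, Polynomial.aeval_eq_sum_range' ((Polynomial.natDegree_lt_iff_degree_lt hp0).2 hdeg),
          Finset.sum_range]
        simp [hv]
    rw [hsum]
    exact Submodule.sum_mem _ fun k _ =>
      Submodule.smul_mem _ _ (Submodule.subset_span (Set.mem_range_self k))
  exact ⟨Basis.mk hli hsp, fun k => by rw [Basis.mk_apply, hv]⟩

/-- If `1, m, …, m ^ (s - 1)` are linearly independent then the eigenvalues of `m` on the `s`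
summands are distinct. -/
theorem injective_of_linearIndependent_pow (hρ : Function.Injective ρ)
    (hN : DirectSum.IsInternal N) (hm : ∀ i, ∀ u ∈ N i, ρ m u = c i • u)
    (hli : LinearIndependent K fun k : Fin s => m ^ (k : ℕ)) : Function.Injective c := by
  intro i j hij
  by_contra hne
  -- Since `c i = c j`, dropping the factor at `j` loses no root, and the degree falls to `s - 1`.
  set q : Polynomial K := ∏ k ∈ Finset.univ.erase j, (Polynomial.X - Polynomial.C (c k)) with hq
  have hmonic : q.Monic := Polynomial.monic_prod_X_sub_C _ _
  have hdeg : q.natDegree = s - 1 := by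
    rw [hq, Polynomial.natDegree_finsetProd_X_sub_C_eq_card,
      Finset.card_erase_of_mem (Finset.mem_univ j), Finset.card_univ, Fintype.card_fin]
  have hs : 0 < s := j.pos
  have hroot : ∀ k, q.eval (c k) = 0 := fun k => by
    rw [hq, Polynomial.eval_prod]
    by_cases hk : k = j
    · refine Finset.prod_eq_zero (Finset.mem_erase.2 ⟨hne, Finset.mem_univ i⟩) ?_
      simp [hij, hk]
    · exact Finset.prod_eq_zero (Finset.mem_erase.2 ⟨hk, Finset.mem_univ k⟩) (by simp)
  have hzero : 0 = Polynomial.aeval m q := eq_aeval_of_forall_apply_eq hρ hN hm fun k u _ => by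
    rw [hroot, map_zero, zero_smul, LinearMap.zero_apply]
  rw [Polynomial.aeval_eq_sum_range' (n := s) (by omega), Finset.sum_range] at hzero
  have h0 := Fintype.linearIndependent_iffₛ.1 hli (fun k => q.coeff k) 0 (by simpa using hzero.symm)
    ⟨s - 1, by omega⟩
  have h1 := hmonic.coeff_natDegree
  rw [hdeg] at h1
  exact one_ne_zero (h1.symm.trans h0)

theorem linearIndependent_of_basis_subalgebra {R : Subalgebra K A} {ι : Type*} (B : Basis ι K R)
    {v : ι → A} (hB : ∀ k, (B k : A) = v k) : LinearIndependent K v := by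
  obtain rfl : (fun k => (B k : A)) = v := funext hB
  exact B.linearIndependent.map_injOn R.val.toLinearMap Subtype.val_injective.injOn

end Spectral

/-! ### Invariants as endomorphisms of the tensor product -/

section TensorOp

variable {𝔤 : Type*} [LieRing 𝔤] [LieAlgebra ℂ 𝔤]
  {V W : Type*} [AddCommGroup V] [Module ℂ V] [LieRingModule 𝔤 V] [LieModule ℂ 𝔤 V]
  [AddCommGroup W] [Module ℂ W] [LieRingModule 𝔤 W] [LieModule ℂ 𝔤 W]

theorem tensorOp_tmul_tmul (f : End ℂ V) (g : End ℂ W) (v : V) (w : W) :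
    tensorOp (f ⊗ₜ[ℂ] g) (v ⊗ₜ[ℂ] w) = f v ⊗ₜ[ℂ] g w := rfl

theorem tensorOp_injective [FiniteDimensional ℂ V] [FiniteDimensional ℂ W] :
    Function.Injective (tensorOp : End ℂ V ⊗[ℂ] End ℂ W →ₐ[ℂ] End ℂ (V ⊗[ℂ] W)) := by
  have h : ∀ a : End ℂ V ⊗[ℂ] End ℂ W, tensorOp a = homTensorHomEquiv ℂ V W V W a := fun a => by
    rw [homTensorHomEquiv_apply]
    induction a with
    | zero => simp
    | add a b ha hb => rw [map_add, map_add, ha, hb]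
    | tmul f g => rfl
  intro a b hab
  rw [h, h] at hab
  exact (homTensorHomEquiv ℂ V W V W).injective hab

theorem tensorOp_lie (x : 𝔤) (a : End ℂ V ⊗[ℂ] End ℂ W) :
    tensorOp ⁅x, a⁆ = ⁅x, tensorOp a⁆ := by
  induction a with
  | zero => simp
  | add a b ha hb => rw [lie_add, map_add, map_add, lie_add, ha, hb]
  | tmul f g =>
    refine TensorProduct.ext' fun v w => ?_
    rw [LieHom.lie_apply, TensorProduct.LieModule.lie_tmul_right, map_add, LinearMap.add_apply]
    simp only [tensorOp_tmul_tmul, TensorProduct.LieModule.lie_tmul_right, LieHom.lie_apply,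
      map_add, TensorProduct.sub_tmul, TensorProduct.tmul_sub]
    abel

/-- Holds because `tensorOp` is injective and `𝔤`-equivariant. -/
theorem mem_invariantAlgebra_iff [FiniteDimensional ℂ V] [FiniteDimensional ℂ W]
    (a : End ℂ V ⊗[ℂ] End ℂ W) : a ∈ invariantAlgebra 𝔤 V W ↔
      ∀ (x : 𝔤) (u : V ⊗[ℂ] W), tensorOp a ⁅x, u⁆ = ⁅x, tensorOp a u⁆ := by
  change (∀ x : 𝔤, ⁅x, a⁆ = 0) ↔ _
  refine forall_congr' fun x => ?_
  rw [← tensorOp_injective.eq_iff, tensorOp_lie, map_zero, LinearMap.ext_iff]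
  refine forall_congr' fun u => ?_
  rw [LieHom.lie_apply, LinearMap.zero_apply, sub_eq_zero, eq_comm]

end TensorOp

/-! ### `M(C)` and the Casimir operator of the Killing form -/

section Casimir

variable {𝔤 : Type*} [LieRing 𝔤] [LieAlgebra ℂ 𝔤] [FiniteDimensional ℂ 𝔤] [IsSimple ℂ 𝔤]
  {ι : Type*} [Fintype ι] [DecidableEq ι] (x : Basis ι ℂ 𝔤)
  (V W : Type*) [AddCommGroup V] [Module ℂ V] [LieRingModule 𝔤 V] [LieModule ℂ 𝔤 V]
  [AddCommGroup W] [Module ℂ W] [LieRingModule 𝔤 W] [LieModule ℂ 𝔤 W]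

variable (𝔤) in
theorem killingForm_isSymm : (killingForm ℂ 𝔤).IsSymm :=
  ⟨fun x y => traceForm_comm ℂ 𝔤 𝔤 x y⟩

/-- The pairing `(y, z) ↦ π_V y ⊗ π_W z`. -/
def toEndTmul : 𝔤 →ₗ[ℂ] 𝔤 →ₗ[ℂ] End ℂ V ⊗[ℂ] End ℂ W :=
  (TensorProduct.mk ℂ (End ℂ V) (End ℂ W)).compl₁₂
    (toEnd ℂ 𝔤 V : 𝔤 →ₗ[ℂ] End ℂ V) (toEnd ℂ 𝔤 W : 𝔤 →ₗ[ℂ] End ℂ W)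

theorem toEndTmul_apply (y z : 𝔤) :
    toEndTmul V W y z = toEnd ℂ 𝔤 V y ⊗ₜ[ℂ] toEnd ℂ 𝔤 W z := rfl

theorem casimirM_mem_invariantAlgebra : casimirM x V W ∈ invariantAlgebra 𝔤 V W := by
  intro y
  rw [← sum_lie_dualBasis_add (IsKilling.killingForm_nondegenerate ℂ 𝔤) x (killingForm_isSymm 𝔤)
    (traceForm_lieInvariant ℂ 𝔤 𝔤) (toEndTmul V W) y, casimirM, lie_sum]
  refine Finset.sum_congr rfl fun i _ => ?_
  have hV : ∀ z, ⁅y, toEnd ℂ 𝔤 V z⁆ = toEnd ℂ 𝔤 V ⁅y, z⁆ := fun z => by ext; simp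
  have hW : ∀ z, ⁅y, toEnd ℂ 𝔤 W z⁆ = toEnd ℂ 𝔤 W ⁅y, z⁆ := fun z => by ext; simp
  rw [TensorProduct.LieModule.lie_tmul_right, hV, hW, toEndTmul_apply, toEndTmul_apply]
  rfl

theorem casimirEnd_tmul (v : V) (w : W) :
    casimirEnd (V ⊗[ℂ] W) (IsKilling.killingForm_nondegenerate ℂ 𝔤) x (v ⊗ₜ w) =
      casimirEnd V (IsKilling.killingForm_nondegenerate ℂ 𝔤) x v ⊗ₜ w +
      v ⊗ₜ casimirEnd W (IsKilling.killingForm_nondegenerate ℂ 𝔤) x w +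
      (2 : ℂ) • tensorOp (casimirM x V W) (v ⊗ₜ w) := by
  have hswap : casimirM x V W =
      ∑ i, toEnd ℂ 𝔤 V (killingDualBasis x i) ⊗ₜ[ℂ] toEnd ℂ 𝔤 W (x i) :=
    (sum_dualBasis_comm (IsKilling.killingForm_nondegenerate ℂ 𝔤) x (killingForm_isSymm 𝔤)
      (toEndTmul V W)).symm
  rw [two_smul]
  -- The two cross terms carry the basis and its dual in opposite orders, so one copy of `M(C)` is
  -- swapped.
  nth_rewrite 2 [hswap]
  simp only [casimirM, casimirEnd_apply, map_sum, LinearMap.sum_apply, tensorOp_tmul_tmul,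
    TensorProduct.sum_tmul, TensorProduct.tmul_sum, TensorProduct.LieModule.lie_tmul_right,
    toEnd_apply_apply, lie_add, ← Finset.sum_add_distrib, killingDualBasis]
  refine Finset.sum_congr rfl fun i _ => ?_
  abel

variable [FiniteDimensional ℂ V] [IsIrreducible ℂ 𝔤 V] [FiniteDimensional ℂ W]
  [IsIrreducible ℂ 𝔤 W]

/-- On `V ⊗ W` the operator `2 M(C)` differs from the Casimir operator by a scalar. -/
theorem exists_casimirEnd_eq : ∃ a : ℂ,
    casimirEnd (V ⊗[ℂ] W) (IsKilling.killingForm_nondegenerate ℂ 𝔤) x =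
      a • (1 : End ℂ (V ⊗[ℂ] W)) + (2 : ℂ) • tensorOp (casimirM x V W) := by
  obtain ⟨a, ha⟩ := exists_eq_smul_of_commute (L := 𝔤) _
    (casimirEnd_lie (M := V) (IsKilling.killingForm_nondegenerate ℂ 𝔤) x (killingForm_isSymm 𝔤)
      (traceForm_lieInvariant ℂ 𝔤 𝔤))
  obtain ⟨b, hb⟩ := exists_eq_smul_of_commute (L := 𝔤) _
    (casimirEnd_lie (M := W) (IsKilling.killingForm_nondegenerate ℂ 𝔤) x (killingForm_isSymm 𝔤)
      (traceForm_lieInvariant ℂ 𝔤 𝔤))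
  refine ⟨a + b, TensorProduct.ext' fun v w => ?_⟩
  rw [casimirEnd_tmul, ha, hb]
  simp [add_smul, TensorProduct.smul_tmul']

theorem commute_tensorOp_casimirM {T : End ℂ (V ⊗[ℂ] W)}
    (hT : ∀ (y : 𝔤) (u : V ⊗[ℂ] W), T ⁅y, u⁆ = ⁅y, T u⁆) :
    Commute T (tensorOp (casimirM x V W)) := by
  obtain ⟨a, ha⟩ := exists_casimirEnd_eq x V W
  have hC : Commute T
      (casimirEnd (V ⊗[ℂ] W) (IsKilling.killingForm_nondegenerate ℂ 𝔤) x) := by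
    refine LinearMap.ext fun u => ?_
    simp only [Module.End.mul_apply, casimirEnd_apply, map_sum, hT]
  have h2 : tensorOp (casimirM x V W) = (2⁻¹ : ℂ) •
      (casimirEnd (V ⊗[ℂ] W) (IsKilling.killingForm_nondegenerate ℂ 𝔤) x -
        a • (1 : End ℂ (V ⊗[ℂ] W))) := by
    rw [ha, add_sub_cancel_left, smul_smul, inv_mul_cancel₀ two_ne_zero, one_smul]
  rw [h2]
  exact (hC.sub_right ((Commute.one_right T).smul_right a)).smul_right _

end Casimir

end SMF

end

/-! ### The main theorem -/

theorem theorem3p4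
    {𝔤 : Type*} [LieRing 𝔤] [LieAlgebra ℂ 𝔤] [FiniteDimensional ℂ 𝔤] [LieAlgebra.IsSimple ℂ 𝔤]
    (H : LieSubalgebra ℂ 𝔤) [H.IsCartanSubalgebra]
    (Δ : (LieAlgebra.IsKilling.rootSystem H).Base)
    {ι : Type*} [Fintype ι] [DecidableEq ι] (x : Module.Basis ι ℂ 𝔤)
    (l ν : Module.Dual ℂ H)
    (hl : SMF.IsDominantIntegral Δ l) (hν : SMF.IsDominantIntegral Δ ν)
    (V : Type*) [AddCommGroup V] [Module ℂ V] [LieRingModule 𝔤 V] [LieModule ℂ 𝔤 V]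
    [FiniteDimensional ℂ V] [LieModule.IsIrreducible ℂ 𝔤 V]
    (hV : SMF.HasHighestWeight Δ l V) (hmf : SMF.IsMultiplicityFree H V)
    (W : Type*) [AddCommGroup W] [Module ℂ W] [LieRingModule 𝔤 W] [LieModule ℂ 𝔤 W]
    [FiniteDimensional ℂ W] [LieModule.IsIrreducible ℂ 𝔤 W]
    (hW : SMF.HasHighestWeight Δ ν W) :
    (∃ (s : ℕ) (N : Fin s → LieSubmodule ℂ 𝔤 (V ⊗[ℂ] W)), SMF.IsIrreducibleDecomposition N) ∧
    ∀ (s : ℕ) (N : Fin s → LieSubmodule ℂ 𝔤 (V ⊗[ℂ] W)), SMF.IsIrreducibleDecomposition N →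
      ∃ c : Fin s → ℂ,
        (∀ i, ∀ u ∈ N i, SMF.tensorOp (SMF.casimirM x V W) u = c i • u) ∧
        ((∀ i j, i ≠ j → c i ≠ c j) ↔
          ∃ B : Module.Basis (Fin s) ℂ (SMF.invariantAlgebra 𝔤 V W),
            ∀ k : Fin s, (B k : Module.End ℂ V ⊗[ℂ] Module.End ℂ W) =
              SMF.casimirM x V W ^ (k : ℕ)) := by
  refine ⟨?_, fun s N hN => ?_⟩
  · obtain ⟨s, N, h1, h2⟩ := SMF.exists_isInternal_isIrreducible ℂ 𝔤 (V ⊗[ℂ] W)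
    exact ⟨s, N, h1, h2⟩
  have hρ := SMF.tensorOp_injective (V := V) (W := W)
  have hirr := hN.irreducible
  have hinv := SMF.casimirM_mem_invariantAlgebra x V W
  have hinv' := (SMF.mem_invariantAlgebra_iff _).1 hinv
  -- Preservation of `N i` has to be assumed: an intertwiner may mix isomorphic summands. For `M(C)`
  -- it is automatic; for other invariants it comes from the distinctness of the `c i`.
  have hschur : ∀ T : Module.End ℂ (V ⊗[ℂ] W),
      (∀ (y : 𝔤) (u : V ⊗[ℂ] W), T ⁅y, u⁆ = ⁅y, T u⁆) → ∀ i, (∀ u ∈ N i, T u ∈ N i) →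
      ∃ t : ℂ, ∀ u ∈ N i, T u = t • u := by
    intro T hT i hTi
    have := hirr i
    obtain ⟨t, ht⟩ := SMF.exists_eq_smul_of_commute (L := 𝔤) (M := N i)
      (T.restrict (p := (N i).toSubmodule) (q := (N i).toSubmodule) hTi)
      (fun y u => Subtype.ext (hT y u))
    exact ⟨t, fun u hu => congrArg Subtype.val (ht ⟨u, hu⟩)⟩
  have hpres : ∀ i, ∀ u ∈ N i, SMF.tensorOp (SMF.casimirM x V W) u ∈ N i := by
    intro i u hu
    obtain ⟨a, ha⟩ := SMF.exists_casimirEnd_eq x V W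
    have h1 := LinearMap.congr_fun ha u
    have h2 : SMF.casimirEnd (V ⊗[ℂ] W) (LieAlgebra.IsKilling.killingForm_nondegenerate ℂ 𝔤) x u
        ∈ N i := by
      rw [SMF.casimirEnd_apply]
      exact sum_mem fun j _ => (N i).lie_mem ((N i).lie_mem hu)
    have h3 : SMF.tensorOp (SMF.casimirM x V W) u = (2⁻¹ : ℂ) •
        (SMF.casimirEnd (V ⊗[ℂ] W) (LieAlgebra.IsKilling.killingForm_nondegenerate ℂ 𝔤) x u -
          a • u) := by
      rw [h1]
      simp
    rw [h3]
    exact (N i).smul_mem _ (sub_mem h2 ((N i).smul_mem _ hu))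
  choose c hc using fun i => hschur _ hinv' i (hpres i)
  have hN0 : ∀ i, (N i).toSubmodule ≠ ⊥ := fun i h => by
    have := hirr i
    have := LieModule.nontrivial_of_isIrreducible ℂ 𝔤 (N i)
    exact (LieSubmodule.nontrivial_iff_ne_bot ℂ 𝔤 (V ⊗[ℂ] W)).1 this
      ((LieSubmodule.toSubmodule_eq_bot _).1 h)
  refine ⟨c, hc, fun h => ?_, ?_⟩
  · have hcinj : Function.Injective c := fun i j hij => by_contra fun hne => h i j hne hij
    refine SMF.exists_basis_pow (N := fun i => (N i).toSubmodule) hρ hN.isInternal hN0 hc hcinj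
      (SMF.invariantAlgebra 𝔤 V W) hinv fun a ha => ?_
    have ha' := (SMF.mem_invariantAlgebra_iff (𝔤 := 𝔤) (V := V) (W := W) a).1 ha
    have hcomm := SMF.commute_tensorOp_casimirM x V W ha'
    have hst : ∀ i, ∃ t : ℂ, ∀ u ∈ N i, SMF.tensorOp a u = t • u := fun i =>
      hschur _ ha' i fun u hu =>
        SMF.apply_mem_of_commute (N := fun i => (N i).toSubmodule) hN.isInternal hcinj hc hcomm hu
    choose t ht using hst
    exact ⟨t, ht⟩
  · rintro ⟨B, hB⟩ i j hij hcij
    exact hij (SMF.injective_of_linearIndependent_pow (N := fun i => (N i).toSubmodule) hρ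
      hN.isInternal hc
      (SMF.linearIndependent_of_basis_subalgebra B hB) hcij)
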